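/- Let $S$ be a hyperbolic space, i.e. a geodesic metric space (not necessarily proper) for which there is $\delta\ge 0$ such that every side of every geodesic triangle lies in the $\delta$-neighbourhood of the union of the other two sides. Let $\partial S$ be its Gromov boundary (equivalence classes of sequences converging at infinity), and equip $S\cup\partial S$ with its usual topology. For a group $K$ acting on $S$ by isometries let $\Lambda(K)=\overline{Ks}\cap\partial S$ be the limit set, where $s\in S$ and the closure is taken in $S\cup\partial S$ (it does not depend on $s$). The action of $K$ is \emph{of general type} if $\Lambda(K)$ is infinite and $K$ fixes no point of $\partial S$; it is \emph{elliptic} if all orbits of $K$ in $S$ are bounded. Let $G$ be a countable group with an isometric action of general type on $S$. Put $E(G)=\{g\in G\mid gx=x\ \ \forall x\in\Lambda(G)\}$ (the elliptic radical). A subgroup $H\le G$ is \emph{geometrically dense} if $H$ fixes no point of $\partial S$ and $\Lambda(H)=\Lambda(G)$. A subgroup $H\le G$ is \emph{recurrent} if for every $g\in G$ and every open neighbourhood $\mathcal U$ of $H$ in the space $\mathrm{Sub}(G)$ of subgroups of $G$ (with the topology induced by the product topology on $\{0,1\}^G$) there are infinitely many $n\in\mathbb N$ with $g^nHg^{-n}\in\mathcal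 U$. Then every recurrent subgroup $H$ of $G$ is geometrically dense or contained in $E(G)$. Moreover, if $H$ is geometrically dense, then the action of $H$ on $S$ is of general type, and if $H\le E(G)$, then $H$ is elliptic. -/

import Mathlib

open Filter Topology

noncomputable section

namespace HypAction

/-! ### Hyperbolic metric spaces -/

section Hyperbolic

variable {S : Type*} [MetricSpace S]

/-- `A` is (the image of) a geodesic segment from `x` to `y`. -/
def IsGeodesicSegment (x y : S) (A : Set S) : Prop :=
  ∃ γ : ℝ → S, γ 0 = x ∧ γ (dist x y) = y ∧
    (∀ a ∈ Set.Icc 0 (dist x y), ∀ b ∈ Set.Icc 0 (dist x y), dist (γ a) (γ b) = |a - b|) ∧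
    A = γ '' Set.Icc 0 (dist x y)

/-- Every side of every geodesic triangle lies in the closed `δ`-neighbourhood of the union of
the two other sides. -/
def HasSlimTriangles (S : Type*) [MetricSpace S] (δ : ℝ) : Prop :=
  ∀ (x y z : S) (A B C : Set S), IsGeodesicSegment x y A → IsGeodesicSegment y z B →
    IsGeodesicSegment z x C → ∀ p ∈ A, ∃ q ∈ B ∪ C, dist p q ≤ δ

/-- A hyperbolic space: a geodesic metric space with uniformly slim triangles (no properness
or completeness is required). -/
structure IsHyperbolicSpace (S : Type*) [MetricSpace S] : Prop where
  geodesic : ∀ x y : S, ∃ A : Set S, IsGeodesicSegment x y A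
  slim : ∃ δ : ℝ, 0 ≤ δ ∧ HasSlimTriangles S δ

/-- The Gromov product `(x, y)_s`. -/
def gromovProduct (s x y : S) : ℝ :=
  (dist x s + dist y s - dist x y) / 2

/-- `(x_i, y_j)_s → ∞` as `i, j → ∞` (for every base point `s`). -/
def AsymptoticSeq (x y : ℕ → S) : Prop :=
  ∀ s : S, Tendsto (fun p : ℕ × ℕ => gromovProduct s (x p.1) (y p.2)) atTop atTop

/-- Sequences that converge at infinity. -/
def SeqAtInfinity (S : Type*) [MetricSpace S] : Type _ :=
  {x : ℕ → S // AsymptoticSeq x x}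

/-- The Gromov boundary: sequences converging at infinity up to equivalence. The relation
divided out is an equivalence relation when `S` is hyperbolic. -/
def GromovBoundary (S : Type*) [MetricSpace S] : Type _ :=
  Quot (fun x y : SeqAtInfinity S => AsymptoticSeq x.1 y.1)

/-- The space `S ∪ ∂S`. -/
def Bordification (S : Type*) [MetricSpace S] : Type _ :=
  S ⊕ GromovBoundary S

/-- The inclusion of `S` in `S ∪ ∂S`. -/
def ofPoint (x : S) : Bordification S := Sum.inl x

/-- The inclusion of `∂S` in `S ∪ ∂S`. -/
def ofBoundary (ξ : GromovBoundary S) : Bordification S := Sum.inr ξ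

/-- The sequence `x` of points of `S` converges to the boundary point `ξ`, that is, it converges
at infinity and its class is `ξ`. -/
def ConvergesToBoundary (x : ℕ → S) (ξ : GromovBoundary S) : Prop :=
  ∃ hx : AsymptoticSeq x x, (Quot.mk _ ⟨x, hx⟩ : GromovBoundary S) = ξ

/-- Convergence of a sequence of points of `S` to a point of `S ∪ ∂S`. -/
def ConvergesTo (x : ℕ → S) : Bordification S → Prop
  | Sum.inl y => Tendsto x atTop (𝓝 y)
  | Sum.inr ξ => ConvergesToBoundary x ξ

/-- The basic neighbourhood of `ξ ∈ ∂S` in `S ∪ ∂S`: the points `p` whose Gromov product with `ξ`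
is at least `R`, i.e. `(x_i, y_j)_s ≥ R` for all large `i, j`, for some sequences `x_i → ξ` and
`y_j → p`. -/
def boundaryNhd (s : S) (R : ℝ) (ξ : GromovBoundary S) : Set (Bordification S) :=
  {p | ∃ x y : ℕ → S, ConvergesToBoundary x ξ ∧ ConvergesTo y p ∧
    ∀ᶠ ij : ℕ × ℕ in atTop, R ≤ gromovProduct s (x ij.1) (y ij.2)}

theorem boundaryNhd_anti (s : S) {R R' : ℝ} (h : R ≤ R') (ξ : GromovBoundary S) :
    boundaryNhd s R' ξ ⊆ boundaryNhd s R ξ := by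
  rintro p ⟨x, y, hx, hy, hxy⟩
  exact ⟨x, y, hx, hy, hxy.mono fun _ hij => h.trans hij⟩

/-- The topology of `S ∪ ∂S`: it restricts to the metric topology on the open subset `S`, and the
sets `boundaryNhd s R ξ`, `R ∈ ℝ`, form a neighbourhood base at `ξ ∈ ∂S`. -/
instance bordificationTopology : TopologicalSpace (Bordification S) where
  IsOpen U := IsOpen (ofPoint ⁻¹' U) ∧
    ∀ ξ : GromovBoundary S, ofBoundary ξ ∈ U → ∀ s : S, ∃ R : ℝ, boundaryNhd s R ξ ⊆ U
  isOpen_univ := ⟨isOpen_univ, fun _ _ _ => ⟨0, Set.subset_univ _⟩⟩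
  isOpen_inter := by
    rintro U V ⟨hU, hU'⟩ ⟨hV, hV'⟩
    refine ⟨hU.inter hV, fun ξ hξ s => ?_⟩
    obtain ⟨R, hR⟩ := hU' ξ hξ.1 s
    obtain ⟨R', hR'⟩ := hV' ξ hξ.2 s
    exact ⟨max R R', Set.subset_inter ((boundaryNhd_anti s (le_max_left _ _) ξ).trans hR)
      ((boundaryNhd_anti s (le_max_right _ _) ξ).trans hR')⟩
  isOpen_sUnion := by
    intro 𝒰 h𝒰
    refine ⟨?_, ?_⟩
    · rw [Set.preimage_sUnion]
      exact isOpen_biUnion fun U hU => (h𝒰 U hU).1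
    · rintro ξ ⟨U, hU, hξ⟩ s
      obtain ⟨R, hR⟩ := (h𝒰 U hU).2 ξ hξ s
      exact ⟨R, hR.trans (Set.subset_sUnion_of_mem hU)⟩

end Hyperbolic

/-! ### Isometric actions -/

section Action

variable (G : Type*) [Group G] (S : Type*) [MetricSpace S] [MulAction G S] [IsIsometricSMul G S]

/-- The restriction of an isometric action to a subgroup is isometric. -/
instance subgroupIsIsometricSMul (H : Subgroup G) : IsIsometricSMul H S :=
  ⟨fun h => isometry_smul S (h : G)⟩

variable {G S} in
theorem AsymptoticSeq.smul (g : G) {x y : ℕ → S} (h : AsymptoticSeq x y) :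
    AsymptoticSeq (fun i => g • x i) (fun i => g • y i) := by
  intro s
  have hs := h (g⁻¹ • s)
  have key : ∀ a b : S, gromovProduct s (g • a) (g • b) = gromovProduct (g⁻¹ • s) a b := by
    intro a b
    have hd : ∀ c : S, dist (g • c) s = dist c (g⁻¹ • s) := fun c => by
      rw [← dist_smul g c (g⁻¹ • s), smul_inv_smul]
    simp only [gromovProduct, hd, dist_smul]
  simpa only [key] using hs

/-- The action on `∂S` induced by the action on `S`: `g • lim x_i = lim (g • x_i)`. -/
instance boundaryAction : MulAction G (GromovBoundary S) where
  smul g := Quot.map (fun x : SeqAtInfinity S => ⟨fun i => g • x.1 i, AsymptoticSeq.smul g x.2⟩)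
    (fun _ _ h => AsymptoticSeq.smul g h)
  one_smul := by
    rintro ⟨x⟩
    exact congrArg (Quot.mk _) (Subtype.ext (funext fun i => one_smul G (x.1 i)))
  mul_smul := by
    rintro g h ⟨x⟩
    exact congrArg (Quot.mk _) (Subtype.ext (funext fun i => mul_smul g h (x.1 i)))

/-- The limit set `Λ(G)`: the boundary points in the closure, in `S ∪ ∂S`, of an orbit `Gs`
(for `S` hyperbolic this does not depend on `s`). -/
def limitSet : Set (GromovBoundary S) :=
  {ξ | ∃ s : S, ofBoundary ξ ∈ closure (ofPoint '' MulAction.orbit G s)}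

/-- The action of `G` on `S` is non-elementary: `Λ(G)` is infinite. -/
def IsNonElementary : Prop :=
  (limitSet G S).Infinite

/-- The action of `G` on `S` is of general type: it is non-elementary and no point of `∂S` is
fixed by `G`. -/
def IsGeneralType : Prop :=
  IsNonElementary G S ∧ ¬ ∃ ξ : GromovBoundary S, ∀ g : G, g • ξ = ξ

/-- The action of `G` on `S` is elliptic: it has bounded orbits. -/
def IsElliptic : Prop :=
  ∀ s : S, Bornology.IsBounded (MulAction.orbit G s)

/-- The elliptic radical `E(G)`: the elements of `G` that fix every point of `Λ(G)`. -/
def ellipticRadical : Subgroup G :=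
  fixingSubgroup G (limitSet G S)

variable {G} in
/-- `H ≤ G` is geometrically dense: it fixes no point of `∂S`, and `Λ(H) = Λ(G)`. -/
def IsGeometricallyDense (H : Subgroup G) : Prop :=
  (¬ ∃ ξ : GromovBoundary S, ∀ h ∈ H, h • ξ = ξ) ∧ limitSet H S = limitSet G S

end Action

/-! ### Recurrent subgroups -/

section Recurrent

variable {G : Type*} [Group G]

open Classical in
/-- The topology on `Sub(G)` induced by the product topology on `{0,1}^G`, where each factor
`{0,1}` is discrete. -/
@[reducible]
def subgroupTopology (G : Type*) [Group G] : TopologicalSpace (Subgroup G) :=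
  TopologicalSpace.induced (fun (H : Subgroup G) (g : G) => decide (g ∈ H))
    (inferInstance : TopologicalSpace (G → Bool))

/-- The conjugate `g H g⁻¹`. -/
def conjSubgroup (g : G) (H : Subgroup G) : Subgroup G :=
  H.map (MulAut.conj g).toMonoidHom

/-- `H` is recurrent: for every `g ∈ G` and every open neighbourhood `U` of `H` in `Sub(G)`,
there are infinitely many `n ∈ ℕ` with `g ^ n H g ^ (-n) ∈ U`. -/
def IsRecurrentSubgroup (H : Subgroup G) : Prop :=
  ∀ (g : G) (U : Set (Subgroup G)), IsOpen[subgroupTopology G] U → H ∈ U →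
    {n : ℕ | conjSubgroup (g ^ n) H ∈ U}.Infinite

end Recurrent

end HypAction

end

/-!
Write `N(ξ, R)` for the set of points of `S` whose Gromov product with `ξ ∈ ∂S` is at least `R`.
An isometry `a` maps every point that is not close to `a⁻¹s` close to `as`. Given distinct limit
points `ξ` and `η`, this allows one to build `g ∈ G` all of whose positive powers move `s` into
`N(ξ, R)` and all of whose negative powers move `s` into `N(η, R)`.

Suppose that `h ∈ H` moves a limit point `ξ`; then `h` separates every point close to `ξ` from its
image. By recurrence `H` contains `g⁻ⁿhgⁿ` for some `n ≥ 1`. As `gⁿs` is close to `ξ`, the points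
`gⁿs` and `hgⁿs` are separated, so `g⁻ⁿ` maps `hgⁿs` close to `η`; hence `η ∈ Λ(H)`. If `H` fixed
`ζ ∈ ∂S`, where we may take `η ≠ ζ`, then `h` would fix `gⁿζ`, although `gⁿζ` is close to `ξ`.

Finally, if an isometry fixes a boundary point and moves `s` far, then it or its inverse moves `s`
close to that point. An isometry that fixes three boundary points therefore moves `s` a bounded
distance, as a point far from `s` is close to at most one of the three.
-/

namespace HypAction

section GromovProduct

variable {S : Type*} [MetricSpace S]

theorem gromovProduct_comm (s x y : S) : gromovProduct s x y = gromovProduct s y x := by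
  simp only [gromovProduct, dist_comm x y, add_comm]

theorem gromovProduct_self (s x : S) : gromovProduct s x x = dist s x := by
  simp only [gromovProduct, dist_self, dist_comm x s]
  ring

theorem gromovProduct_nonneg (s x y : S) : 0 ≤ gromovProduct s x y := by
  have := dist_triangle_right x y s
  simp only [gromovProduct]
  linarith

theorem gromovProduct_le_dist_left (s x y : S) : gromovProduct s x y ≤ dist s x := by
  have := dist_triangle_left y s x
  simp only [gromovProduct, dist_comm s x]
  linarith

theorem gromovProduct_le_dist_right (s x y : S) : gromovProduct s x y ≤ dist s y :=
  gromovProduct_comm s x y ▸ gromovProduct_le_dist_left s y x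

theorem gromovProduct_le_add_dist_base (s t x y : S) :
    gromovProduct s x y ≤ gromovProduct t x y + dist s t := by
  have := dist_triangle_right x s t
  have := dist_triangle_right y s t
  simp only [gromovProduct]
  linarith

theorem gromovProduct_le_add_dist_left (s x y z : S) :
    gromovProduct s x z ≤ gromovProduct s y z + dist x y := by
  have := dist_triangle x y s
  have := dist_triangle_left y z x
  simp only [gromovProduct]
  linarith

theorem gromovProduct_add_gromovProduct (s x y : S) :
    gromovProduct s x y + gromovProduct x s y = dist s x := by
  simp only [gromovProduct, dist_comm y s, dist_comm y x, dist_comm x s]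
  ring

end GromovProduct

section FourPoint

/-- Gromov's four-point condition with constant `δ`, the form of hyperbolicity that makes sense in
metric spaces that need not be geodesic. -/
def IsGromovHyperbolic (S : Type*) [MetricSpace S] (δ : ℝ) : Prop :=
  ∀ s x y z : S, min (gromovProduct s x y) (gromovProduct s y z) - δ ≤ gromovProduct s x z

namespace IsGromovHyperbolic

variable {S : Type*} [MetricSpace S] {δ : ℝ}

theorem nonneg (hδ : IsGromovHyperbolic S δ) (s : S) : 0 ≤ δ := by
  simpa only [gromovProduct_self, dist_self, min_self, zero_sub, neg_nonpos] using hδ s s s s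

theorem le_add_or_le_add (hδ : IsGromovHyperbolic S δ) (s x y z : S) :
    gromovProduct s x y ≤ gromovProduct s x z + δ ∨
      gromovProduct s y z ≤ gromovProduct s x z + δ :=
  min_le_iff.1 (sub_le_iff_le_add.1 (hδ s x y z))

theorem le_trans (hδ : IsGromovHyperbolic S δ) {s x y z : S} {R : ℝ}
    (hxy : R + δ ≤ gromovProduct s x y) (hyz : R + δ ≤ gromovProduct s y z) :
    R ≤ gromovProduct s x z := by
  linarith [hδ s x y z, le_min hxy hyz]

end IsGromovHyperbolic

end FourPoint

section Geodesic

variable {S : Type*} [MetricSpace S] {δ : ℝ} {x y : S} {A : Set S}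

namespace IsGeodesicSegment

theorem left_mem (hA : IsGeodesicSegment x y A) : x ∈ A := by
  obtain ⟨γ, hγ_left, -, -, rfl⟩ := hA
  exact ⟨0, ⟨le_rfl, dist_nonneg⟩, hγ_left⟩

theorem right_mem (hA : IsGeodesicSegment x y A) : y ∈ A := by
  obtain ⟨γ, -, hγ_right, -, rfl⟩ := hA
  exact ⟨_, ⟨dist_nonneg, le_rfl⟩, hγ_right⟩

theorem isPreconnected (hA : IsGeodesicSegment x y A) : IsPreconnected A := by
  obtain ⟨γ, -, -, hγ, rfl⟩ := hA
  refine isPreconnected_Icc.image γ (LipschitzOnWith.continuousOn (K := 1) ?_)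
  exact .of_dist_le_mul fun a ha b hb => by simp [hγ a ha b hb, Real.dist_eq]

theorem dist_add_dist (hA : IsGeodesicSegment x y A) {q : S} (hq : q ∈ A) :
    dist x q + dist q y = dist x y := by
  obtain ⟨γ, hγ_left, hγ_right, hγ, rfl⟩ := hA
  obtain ⟨t, ht, rfl⟩ := hq
  have hx : dist x (γ t) = t := by
    simpa [hγ_left, abs_of_nonneg ht.1] using hγ 0 ⟨le_rfl, dist_nonneg⟩ t ht
  have hy : dist (γ t) y = dist x y - t := by
    simpa [hγ_right, abs_sub_comm t, abs_of_nonneg (sub_nonneg.2 ht.2)] using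
      hγ t ht (dist x y) ⟨dist_nonneg, le_rfl⟩
  rw [hx, hy, add_sub_cancel]

theorem dist_add_dist_le (hA : IsGeodesicSegment x y A) {q : S} (hq : q ∈ A) (p : S) :
    dist x p + dist p y ≤ dist x y + 2 * dist p q := by
  have := hA.dist_add_dist hq
  have := dist_triangle_right x p q
  have := dist_triangle p q y
  linarith

theorem gromovProduct_le_dist (hA : IsGeodesicSegment x y A) {q : S} (hq : q ∈ A) (s : S) :
    gromovProduct s x y ≤ dist s q := by
  have := hA.dist_add_dist hq
  have := dist_triangle_right x s q
  have := dist_triangle_right y s q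
  rw [dist_comm y q] at this
  simp only [gromovProduct]
  linarith

/-- The distances to the two other sides of a triangle agree somewhere on the first side, by
continuity. -/
theorem exists_dist_lt_and_dist_lt (hδ : HasSlimTriangles S δ) {s : S} {B C : Set S}
    (hA : IsGeodesicSegment x y A) (hB : IsGeodesicSegment y s B)
    (hC : IsGeodesicSegment s x C) {ε : ℝ} (hε : δ < ε) :
    ∃ p ∈ A, (∃ q ∈ B, dist p q < ε) ∧ ∃ r ∈ C, dist p r < ε := by
  obtain ⟨p, hp, hpBC⟩ : ∃ p ∈ A, Metric.infDist p C = Metric.infDist p B := by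
    refine hA.isPreconnected.intermediate_value₂ hA.left_mem hA.right_mem
      (Metric.continuous_infDist_pt C).continuousOn (Metric.continuous_infDist_pt B).continuousOn
      ?_ ?_
    · exact (Metric.infDist_zero_of_mem hC.right_mem).trans_le Metric.infDist_nonneg
    · exact (Metric.infDist_zero_of_mem hB.left_mem).trans_le Metric.infDist_nonneg
  have hpB : Metric.infDist p B < ε := by
    obtain ⟨q, hq | hq, hpq⟩ := hδ x y s A B C hA hB hC p hp
    · exact ((Metric.infDist_le_dist_of_mem hq).trans hpq).trans_lt hε
    · exact hpBC ▸ ((Metric.infDist_le_dist_of_mem hq).trans hpq).trans_lt hε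
  exact ⟨p, hp, (Metric.infDist_lt_iff ⟨y, hB.left_mem⟩).1 hpB,
    (Metric.infDist_lt_iff ⟨x, hC.right_mem⟩).1 (hpBC.trans_lt hpB)⟩

end IsGeodesicSegment

theorem IsHyperbolicSpace.exists_dist_le_gromovProduct_add (hS : IsHyperbolicSpace S)
    (hδ : HasSlimTriangles S δ) (hA : IsGeodesicSegment x y A) (s : S) {ε : ℝ} (hε : δ < ε) :
    ∃ p ∈ A, dist s p ≤ gromovProduct s x y + 2 * ε := by
  obtain ⟨B, hB⟩ := hS.geodesic y s
  obtain ⟨C, hC⟩ := hS.geodesic s x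
  obtain ⟨p, hp, ⟨q, hq, hpq⟩, r, hr, hpr⟩ := hA.exists_dist_lt_and_dist_lt hδ hB hC hε
  refine ⟨p, hp, ?_⟩
  have hxy := hA.dist_add_dist hp
  have hys := hB.dist_add_dist_le hq p
  have hsx := hC.dist_add_dist_le hr p
  rw [dist_comm y p, dist_comm p s] at hys
  rw [dist_comm p x, dist_comm s x] at hsx
  simp only [gromovProduct]
  linarith

theorem IsHyperbolicSpace.exists_isGromovHyperbolic (hS : IsHyperbolicSpace S) :
    ∃ δ : ℝ, IsGromovHyperbolic S δ := by
  obtain ⟨δ, -, hδ⟩ := hS.slim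
  refine ⟨2 * (δ + 1) + δ, fun s x y z => ?_⟩
  obtain ⟨A, hA⟩ := hS.geodesic x z
  obtain ⟨B, hB⟩ := hS.geodesic z y
  obtain ⟨C, hC⟩ := hS.geodesic y x
  obtain ⟨p, hp, hsp⟩ := hS.exists_dist_le_gromovProduct_add hδ hA s (lt_add_one δ)
  obtain ⟨q, hq, hpq⟩ := hδ x z y A B C hA hB hC p hp
  have hsq : min (gromovProduct s x y) (gromovProduct s y z) ≤ dist s q := by
    rcases hq with hq | hq
    · exact min_le_of_right_le (gromovProduct_comm s y z ▸ hB.gromovProduct_le_dist hq s)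
    · exact min_le_of_left_le (gromovProduct_comm s x y ▸ hC.gromovProduct_le_dist hq s)
  linarith [dist_triangle s p q]

end Geodesic

section Boundary

variable {S : Type*} [MetricSpace S] {δ : ℝ} {x y : ℕ → S} {ξ η : GromovBoundary S}

theorem asymptoticSeq_iff (s : S) :
    AsymptoticSeq x y ↔ ∀ R : ℝ, ∃ N, ∀ i ≥ N, ∀ j ≥ N, R ≤ gromovProduct s (x i) (y j) := by
  refine ⟨fun h R => eventually_atTop_prod_self'.1 ((h s).eventually_ge_atTop R),
    fun h t => tendsto_atTop.2 fun R => eventually_atTop_prod_self'.2 ?_⟩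
  obtain ⟨N, hN⟩ := h (R + dist s t)
  refine ⟨N, fun i hi j hj => ?_⟩
  linarith [hN i hi j hj, gromovProduct_le_add_dist_base s t (x i) (y j)]

theorem AsymptoticSeq.symm (h : AsymptoticSeq x y) : AsymptoticSeq y x := by
  refine (asymptoticSeq_iff (x 0)).2 fun R => ?_
  obtain ⟨N, hN⟩ := (asymptoticSeq_iff (x 0)).1 h R
  exact ⟨N, fun i hi j hj => gromovProduct_comm (x 0) (x j) (y i) ▸ hN j hj i hi⟩

theorem AsymptoticSeq.trans (hδ : IsGromovHyperbolic S δ) {z : ℕ → S} (hxy : AsymptoticSeq x y)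
    (hyz : AsymptoticSeq y z) : AsymptoticSeq x z := by
  refine (asymptoticSeq_iff (x 0)).2 fun R => ?_
  obtain ⟨N, hN⟩ := (asymptoticSeq_iff (x 0)).1 hxy (R + δ)
  obtain ⟨M, hM⟩ := (asymptoticSeq_iff (x 0)).1 hyz (R + δ)
  refine ⟨max N M, fun i hi j hj => ?_⟩
  exact hδ.le_trans (hN i (le_of_max_le_left hi) (max N M) (le_max_left N M))
    (hM (max N M) (le_max_right N M) j (le_of_max_le_right hj))

theorem exists_convergesToBoundary (ξ : GromovBoundary S) :
    ∃ x : ℕ → S, ConvergesToBoundary x ξ := by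
  obtain ⟨x, rfl⟩ := Quot.exists_rep ξ
  exact ⟨x.1, x.2, rfl⟩

theorem ConvergesToBoundary.eq_iff (hδ : IsGromovHyperbolic S δ) (hx : ConvergesToBoundary x ξ)
    (hy : ConvergesToBoundary y η) : ξ = η ↔ AsymptoticSeq x y := by
  have equivalence : Equivalence fun x y : SeqAtInfinity S => AsymptoticSeq x.1 y.1 :=
    ⟨fun x => x.2, AsymptoticSeq.symm, AsymptoticSeq.trans hδ⟩
  obtain ⟨hx, rfl⟩ := hx
  obtain ⟨hy, rfl⟩ := hy
  exact Quot.eq.trans equivalence.eqvGen_iff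

/-- The trace on `S` of the neighbourhood of `ξ ∈ ∂S` formed by the points whose Gromov product with
`ξ`, based at `s`, is at least `R`. Testing against all sequences that converge to `ξ` makes the
notion equivariant under isometries; testing against one of them changes `R` by at most `δ`. -/
def traceNhd (s : S) (R : ℝ) (ξ : GromovBoundary S) : Set S :=
  {p | ∀ x : ℕ → S, ConvergesToBoundary x ξ → ∀ᶠ i in atTop, R ≤ gromovProduct s p (x i)}

variable {s p q : S} {R : ℝ}

theorem traceNhd_anti (s : S) {R R' : ℝ} (h : R ≤ R') (ξ : GromovBoundary S) :
    traceNhd s R' ξ ⊆ traceNhd s R ξ :=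
  fun _ hp x hx => (hp x hx).mono fun _ => h.trans

theorem traceNhd_add_dist_subset (s t : S) (R : ℝ) (ξ : GromovBoundary S) :
    traceNhd t (R + dist t s) ξ ⊆ traceNhd s R ξ := fun p hp x hx => by
  filter_upwards [hp x hx] with i hi
  linarith [gromovProduct_le_add_dist_base t s p (x i)]

theorem le_dist_of_mem_traceNhd (hp : p ∈ traceNhd s R ξ) : R ≤ dist s p := by
  obtain ⟨x, hx⟩ := exists_convergesToBoundary ξ
  obtain ⟨i, hi⟩ := (hp x hx).exists
  exact hi.trans (gromovProduct_le_dist_left s p (x i))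

theorem mem_traceNhd_of_mem_add_dist (hp : p ∈ traceNhd s (R + dist p q) ξ) :
    q ∈ traceNhd s R ξ := fun x hx => by
  filter_upwards [hp x hx] with i hi
  linarith [gromovProduct_le_add_dist_left s p q (x i)]

theorem mem_traceNhd_of_le_gromovProduct (hδ : IsGromovHyperbolic S δ)
    (hp : p ∈ traceNhd s (R + δ) ξ) (hpq : R + δ ≤ gromovProduct s p q) : q ∈ traceNhd s R ξ :=
  fun x hx => (hp x hx).mono fun _ hi => hδ.le_trans (gromovProduct_comm s p q ▸ hpq) hi

theorem ConvergesToBoundary.eventually_mem_traceNhd (hδ : IsGromovHyperbolic S δ)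
    (hx : ConvergesToBoundary x ξ) (s : S) (R : ℝ) : ∀ᶠ i in atTop, x i ∈ traceNhd s R ξ := by
  obtain ⟨N, hN⟩ := (asymptoticSeq_iff s).1 hx.1 (R + δ)
  filter_upwards [eventually_ge_atTop N] with i hi y hy
  obtain ⟨M, hM⟩ := (asymptoticSeq_iff s).1 ((hx.eq_iff hδ hy).1 rfl) (R + δ)
  filter_upwards [eventually_ge_atTop M] with j hj
  exact hδ.le_trans (hN i hi (max N M) (le_max_left N M)) (hM (max N M) (le_max_right N M) j hj)

theorem ConvergesToBoundary.mem_traceNhd (hδ : IsGromovHyperbolic S δ)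
    (hx : ConvergesToBoundary x ξ) (hp : ∃ᶠ i in atTop, R + δ ≤ gromovProduct s p (x i)) :
    p ∈ traceNhd s R ξ := by
  obtain ⟨i, hpi, hi⟩ := (hp.and_eventually (hx.eventually_mem_traceNhd hδ s (R + δ))).exists
  exact mem_traceNhd_of_le_gromovProduct hδ hi (gromovProduct_comm s p (x i) ▸ hpi)

theorem eventually_gromovProduct_le (hδ : IsGromovHyperbolic S δ) (s : S) (hne : ξ ≠ η) :
    ∀ᶠ K : ℝ in atTop, ∀ p ∈ traceNhd s K ξ, ∀ q ∈ traceNhd s K η, gromovProduct s p q ≤ K := by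
  obtain ⟨x, hx⟩ := exists_convergesToBoundary ξ
  obtain ⟨y, hy⟩ := exists_convergesToBoundary η
  have hxy := mt (hx.eq_iff hδ hy).2 hne
  rw [asymptoticSeq_iff s] at hxy
  push Not at hxy
  obtain ⟨R, hR⟩ := hxy
  filter_upwards [eventually_ge_atTop (R + δ + δ)] with K hK p hp q hq
  by_contra! hpq
  obtain ⟨N, hN⟩ := eventually_atTop.1 ((hp x hx).and (hq y hy))
  obtain ⟨i, hi, j, hj, hij⟩ := hR N
  have hpj : R + δ ≤ gromovProduct s p (y j) :=
    hδ.le_trans (hK.trans hpq.le) (hK.trans (hN j hj).2)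
  have hip : R + δ ≤ gromovProduct s (x i) p := by
    rw [gromovProduct_comm]
    linarith [(hN i hi).1, hδ.nonneg s]
  exact hij.not_ge (hδ.le_trans hip hpj)

theorem ofPoint_mem_boundaryNhd (hp : p ∈ traceNhd s R ξ) : ofPoint p ∈ boundaryNhd s R ξ := by
  obtain ⟨x, hx⟩ := exists_convergesToBoundary ξ
  refine ⟨x, fun _ => p, hx, tendsto_const_nhds, ?_⟩
  rw [← prod_atTop_atTop_eq]
  simpa only [gromovProduct_comm s p] using (hp x hx).prod_inl atTop

theorem exists_eventually_mem_traceNhd_of_mem_boundaryNhd (hδ : IsGromovHyperbolic S δ)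
    {b : Bordification S} (hb : b ∈ boundaryNhd s (R + δ) ξ) :
    ∃ y : ℕ → S, ConvergesTo y b ∧ ∀ᶠ j in atTop, y j ∈ traceNhd s R ξ := by
  obtain ⟨x, y, hx, hy, hxy⟩ := hb
  obtain ⟨N, hN⟩ := eventually_atTop_prod_self'.1 hxy
  refine ⟨y, hy, eventually_atTop.2 ⟨N, fun j hj => hx.mem_traceNhd hδ ?_⟩⟩
  exact (eventually_atTop.2 ⟨N, fun i hi =>
    gromovProduct_comm s (x i) (y j) ▸ hN i hi j hj⟩).frequently

/-- The closure in `S ∪ ∂S` of a subset `A` of `S`, described by means of `traceNhd`. -/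
def bordificationClosure (s : S) (A : Set S) : Set (Bordification S) :=
  {b | Sum.elim (· ∈ closure A) (fun ξ => ∀ R : ℝ, (A ∩ traceNhd s R ξ).Nonempty) b}

theorem exists_mem_traceNhd_of_mem_bordificationClosure (hδ : IsGromovHyperbolic S δ) {A : Set S}
    {b : Bordification S} (hb : b ∈ bordificationClosure s A) (hy : ConvergesTo y b)
    (hyξ : ∀ᶠ j in atTop, y j ∈ traceNhd s (R + δ + 1) ξ) : (A ∩ traceNhd s R ξ).Nonempty := by
  have h0 := hδ.nonneg s
  rcases b with p | ζ
  · have hdist : ∀ᶠ j in atTop, dist (y j) p < 1 / 2 :=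
      Metric.tendsto_nhds.1 (show Tendsto y atTop (𝓝 p) from hy) _ one_half_pos
    obtain ⟨j, hjp, hj⟩ := (hdist.and hyξ).exists
    obtain ⟨a, haA, hpa⟩ := Metric.mem_closure_iff.1 hb (1 / 2) one_half_pos
    refine ⟨a, haA, mem_traceNhd_of_mem_add_dist (traceNhd_anti s ?_ ξ hj)⟩
    linarith [dist_triangle (y j) p a]
  · obtain ⟨a, haA, ha⟩ := hb (R + δ)
    obtain ⟨j, hja, hj⟩ := ((ha y hy).and hyξ).exists
    refine ⟨a, haA, mem_traceNhd_of_le_gromovProduct hδ (traceNhd_anti s (by linarith) ξ hj) ?_⟩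
    rwa [gromovProduct_comm]

theorem isClosed_bordificationClosure (hδ : IsGromovHyperbolic S δ) (s : S) (A : Set S) :
    IsClosed (bordificationClosure s A) := by
  refine ⟨isClosed_closure.isOpen_compl, fun ξ hξ t => ?_⟩
  obtain ⟨R, hR⟩ := not_forall.1 hξ
  refine ⟨R + δ + 1 + dist t s + δ, fun b hb hbA => hR ?_⟩
  obtain ⟨y, hy, hyξ⟩ := exists_eventually_mem_traceNhd_of_mem_boundaryNhd hδ hb
  exact exists_mem_traceNhd_of_mem_bordificationClosure hδ hbA hy
    (hyξ.mono fun _ hj => traceNhd_add_dist_subset s t _ ξ hj)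

theorem ofBoundary_mem_closure_iff (hδ : IsGromovHyperbolic S δ) (s : S) (A : Set S)
    (ξ : GromovBoundary S) :
    ofBoundary ξ ∈ closure (ofPoint '' A) ↔ ∀ R : ℝ, (A ∩ traceNhd s R ξ).Nonempty := by
  refine ⟨fun hξ => ?_, fun h => mem_closure_iff.2 fun U hU hξU => ?_⟩
  · refine closure_minimal ?_ (isClosed_bordificationClosure hδ s A) hξ
    exact Set.image_subset_iff.2 subset_closure
  · obtain ⟨R, hR⟩ := hU.2 ξ hξU s
    obtain ⟨a, haA, ha⟩ := h R
    exact ⟨ofPoint a, hR (ofPoint_mem_boundaryNhd ha), a, haA, rfl⟩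

end Boundary

section Action

variable {G : Type*} [Group G] {S : Type*} [MetricSpace S] [MulAction G S] [IsIsometricSMul G S]
  {δ : ℝ} {s p : S} {R K : ℝ} {ξ η : GromovBoundary S}

theorem gromovProduct_smul (g : G) (s x y : S) :
    gromovProduct (g • s) (g • x) (g • y) = gromovProduct s x y := by
  simp only [gromovProduct, dist_smul]

theorem dist_inv_smul_self (g : G) (s : S) : dist s (g⁻¹ • s) = dist s (g • s) := by
  rw [← dist_smul g s (g⁻¹ • s), smul_inv_smul, dist_comm]

theorem gromovProduct_smul_smul (g : G) (s x : S) :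
    gromovProduct s (g • s) (g • x) = dist s (g • s) - gromovProduct s (g⁻¹ • s) x := by
  rw [← gromovProduct_add_gromovProduct s (g • s) (g • x), ← gromovProduct_smul g⁻¹ (g • s),
    inv_smul_smul, inv_smul_smul, add_sub_cancel_right]

theorem ConvergesToBoundary.smul {x : ℕ → S} (g : G) (hx : ConvergesToBoundary x ξ) :
    ConvergesToBoundary (fun i => g • x i) (g • ξ) := by
  obtain ⟨hx, rfl⟩ := hx
  exact ⟨hx.smul g, rfl⟩

theorem smul_mem_traceNhd_smul (g : G) (hp : p ∈ traceNhd s R ξ) :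
    g • p ∈ traceNhd (g • s) R (g • ξ) := fun x hx => by
  filter_upwards [hp _ (inv_smul_smul g ξ ▸ hx.smul g⁻¹)] with i hi
  rwa [← gromovProduct_smul g, smul_inv_smul] at hi

theorem smul_mem_traceNhd_of_gromovProduct_le (hδ : IsGromovHyperbolic S δ) {a : G}
    (ha : a • s ∈ traceNhd s (R + K + δ) ξ) (hp : gromovProduct s (a⁻¹ • s) p ≤ K) :
    a • p ∈ traceNhd s R ξ := by
  have hK : 0 ≤ K := (gromovProduct_nonneg _ _ _).trans hp
  refine mem_traceNhd_of_le_gromovProduct hδ (traceNhd_anti s (by linarith) ξ ha) ?_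
  rw [gromovProduct_smul_smul]
  linarith [le_dist_of_mem_traceNhd ha]

theorem eventually_gromovProduct_smul_le (hδ : IsGromovHyperbolic S δ) (s : S) {t : G}
    (ht : t • ξ ≠ ξ) :
    ∀ᶠ K : ℝ in atTop, ∀ p ∈ traceNhd s K ξ, gromovProduct s (t • p) p ≤ K := by
  obtain ⟨K₀, hK₀⟩ := (eventually_gromovProduct_le hδ s ht).exists
  filter_upwards [eventually_ge_atTop (K₀ + dist (t • s) s)] with K hK p hp
  have htp : t • p ∈ traceNhd s K₀ (t • ξ) :=
    traceNhd_add_dist_subset s (t • s) K₀ _ (traceNhd_anti _ hK _ (smul_mem_traceNhd_smul t hp))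
  have hdist : 0 ≤ dist (t • s) s := dist_nonneg
  linarith [hK₀ _ htp p (traceNhd_anti s (by linarith) ξ hp)]

theorem ConvergesToBoundary.smul_ne (hδ : IsGromovHyperbolic S δ) {x : ℕ → S} {g : G}
    (hx : ConvergesToBoundary x ξ) (hK : ∃ᶠ i in atTop, gromovProduct s (g • x i) (x i) ≤ K) :
    g • ξ ≠ ξ := fun hξ => by
  obtain ⟨N, hN⟩ := (asymptoticSeq_iff s).1 (((hx.smul g).eq_iff hδ hx).1 hξ) (K + 1)
  obtain ⟨i, hi, hiN⟩ := (hK.and_eventually (eventually_ge_atTop N)).exists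
  linarith [hN i hiN i hiN]

theorem mem_traceNhd_or_inv_smul_mem_traceNhd (hδ : IsGromovHyperbolic S δ) {g : G}
    (hg : g • ξ = ξ) (hdist : 2 * (R + δ) ≤ dist s (g • s)) :
    g • s ∈ traceNhd s R ξ ∨ g⁻¹ • s ∈ traceNhd s R ξ := by
  obtain ⟨x, hx⟩ := exists_convergesToBoundary ξ
  have hgx : ConvergesToBoundary (fun i => g • x i) ξ := by simpa only [hg] using hx.smul g
  by_contra! hnot
  have hpos := not_frequently.1 (mt (hgx.mem_traceNhd hδ) hnot.1)
  have hneg := not_frequently.1 (mt (hx.mem_traceNhd hδ) hnot.2)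
  obtain ⟨i, hi_pos, hi_neg⟩ := (hpos.and hneg).exists
  linarith [gromovProduct_smul_smul g s (x i)]

end Action

section LimitSet

variable {G : Type*} [Group G] {S : Type*} [MetricSpace S] [MulAction G S]

theorem limitSet_subgroup_subset (H : Subgroup G) : limitSet H S ⊆ limitSet G S := by
  rintro ξ ⟨s, hs⟩
  refine ⟨s, closure_mono (Set.image_mono ?_) hs⟩
  rintro _ ⟨h, rfl⟩
  exact ⟨h, rfl⟩

variable [IsIsometricSMul G S] {δ : ℝ} {ξ : GromovBoundary S}

theorem mem_limitSet_iff (hδ : IsGromovHyperbolic S δ) (s : S) (ξ : GromovBoundary S) :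
    ξ ∈ limitSet G S ↔ ∀ R : ℝ, ∃ g : G, g • s ∈ traceNhd s R ξ := by
  refine ⟨fun ⟨t, ht⟩ R => ?_, fun h => ⟨s, (ofBoundary_mem_closure_iff hδ s _ ξ).2 fun R => ?_⟩⟩
  · obtain ⟨_, ⟨g, rfl⟩, hg⟩ := (ofBoundary_mem_closure_iff hδ s _ ξ).1 ht (R + dist t s)
    exact ⟨g, mem_traceNhd_of_mem_add_dist (by rwa [dist_smul])⟩
  · obtain ⟨g, hg⟩ := h R
    exact ⟨g • s, ⟨g, rfl⟩, hg⟩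

theorem smul_mem_limitSet (hδ : IsGromovHyperbolic S δ) (g : G) (hξ : ξ ∈ limitSet G S) :
    g • ξ ∈ limitSet G S := by
  obtain ⟨s, -⟩ := id hξ
  refine (mem_limitSet_iff hδ s _).2 fun R => ?_
  obtain ⟨a, ha⟩ := (mem_limitSet_iff hδ s ξ).1 hξ (R + dist (g • s) s)
  refine ⟨g * a, ?_⟩
  rw [mul_smul]
  exact traceNhd_add_dist_subset s (g • s) R _ (smul_mem_traceNhd_smul g ha)

end LimitSet

section Loxodromic

variable {G : Type*} [Group G] {S : Type*} [MetricSpace S] [MulAction G S]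

/-- A criterion for `g` to be loxodromic: the orbit `n ↦ gⁿs` makes steps that are long compared
with the backtracking `(gs, g⁻¹s)_s` at its vertices. -/
structure HasLongSteps (δ : ℝ) (g : G) (s : S) (c : ℝ) : Prop where
  gromovProduct_inv_le : gromovProduct s (g • s) (g⁻¹ • s) ≤ c
  lt_dist : 2 * c + 3 * δ < dist s (g • s)

variable {δ : ℝ} {s : S} {ξ η : GromovBoundary S}

theorem HasLongSteps.nonneg {g : G} {c : ℝ} (h : HasLongSteps δ g s c) : 0 ≤ c :=
  (gromovProduct_nonneg _ _ _).trans h.gromovProduct_inv_le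

theorem exists_eventually_hasLongSteps (hδ : IsGromovHyperbolic S δ) (s : S) (hne : ξ ≠ η) :
    ∃ c : ℝ, ∀ᶠ R in atTop, ∀ g : G,
      g • s ∈ traceNhd s R ξ → g⁻¹ • s ∈ traceNhd s R η → HasLongSteps δ g s c := by
  obtain ⟨c, hc⟩ := (eventually_gromovProduct_le hδ s hne).exists
  refine ⟨c, ?_⟩
  filter_upwards [eventually_ge_atTop c, eventually_gt_atTop (2 * c + 3 * δ)] with R hcR hR g hξ hη
  exact ⟨hc _ (traceNhd_anti s hcR ξ hξ) _ (traceNhd_anti s hcR η hη),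
    hR.trans_le (le_dist_of_mem_traceNhd hξ)⟩

theorem exists_hasLongSteps_or_inv_smul_mem_traceNhd (hδ : IsGromovHyperbolic S δ) {a : G} {R : ℝ}
    (hR : 0 ≤ R) (ha : a • s ∈ traceNhd s (2 * R + 5 * δ) ξ) :
    (∃ c, HasLongSteps δ a s c) ∨ a⁻¹ • s ∈ traceNhd s R ξ := by
  have h0 := hδ.nonneg s
  rcases lt_or_ge (2 * gromovProduct s (a • s) (a⁻¹ • s) + 3 * δ) (dist s (a • s)) with hlt | hge
  · exact .inl ⟨_, le_rfl, hlt⟩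
  · refine .inr (mem_traceNhd_of_le_gromovProduct hδ (traceNhd_anti s (by linarith) ξ ha) ?_)
    linarith [le_dist_of_mem_traceNhd ha]

variable [IsIsometricSMul G S]

namespace HasLongSteps

variable {g : G} {c : ℝ}

theorem inv (h : HasLongSteps δ g s c) : HasLongSteps δ g⁻¹ s c where
  gromovProduct_inv_le := by
    rw [inv_inv, gromovProduct_comm]
    exact h.gromovProduct_inv_le
  lt_dist := (dist_inv_smul_self g s).symm ▸ h.lt_dist

theorem gromovProduct_inv_pow_le (h : HasLongSteps δ g s c) (hδ : IsGromovHyperbolic S δ) (n : ℕ) :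
    gromovProduct s (g⁻¹ • s) (g ^ n • s) ≤ c + δ := by
  induction n with
  | zero =>
    have := gromovProduct_le_dist_right s (g⁻¹ • s) s
    rw [dist_self] at this
    rw [pow_zero, one_smul]
    linarith [h.nonneg, hδ.nonneg s]
  | succ n ih =>
    have hlong := gromovProduct_smul_smul g s (g ^ n • s)
    rw [← mul_smul, ← pow_succ'] at hlong
    rw [gromovProduct_comm]
    rcases hδ.le_add_or_le_add s (g • s) (g ^ (n + 1) • s) (g⁻¹ • s) with hle | hle <;>
      linarith [h.gromovProduct_inv_le, h.lt_dist, hδ.nonneg s]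

theorem le_gromovProduct_pow_succ (h : HasLongSteps δ g s c) (hδ : IsGromovHyperbolic S δ) (n : ℕ) :
    dist s (g • s) - (c + δ) ≤ gromovProduct s (g • s) (g ^ (n + 1) • s) := by
  rw [pow_succ', mul_smul, gromovProduct_smul_smul]
  linarith [h.gromovProduct_inv_pow_le hδ n]

theorem mul_le_dist_pow (h : HasLongSteps δ g s c) (hδ : IsGromovHyperbolic S δ) (n : ℕ) :
    n * (dist s (g • s) - 2 * (c + δ)) ≤ dist s (g ^ n • s) := by
  induction n with
  | zero => simp
  | succ n ih =>
    have hstep := h.le_gromovProduct_pow_succ hδ n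
    have hshift : dist (g • s) (g ^ (n + 1) • s) = dist s (g ^ n • s) := by
      rw [pow_succ', mul_smul, dist_smul]
    simp only [gromovProduct, hshift, dist_comm _ s] at hstep
    push_cast
    linarith

theorem tendsto_dist_pow (h : HasLongSteps δ g s c) (hδ : IsGromovHyperbolic S δ) :
    Tendsto (fun n : ℕ => dist s (g ^ n • s)) atTop atTop := by
  have hpos : 0 < dist s (g • s) - 2 * (c + δ) := by linarith [h.lt_dist, hδ.nonneg s]
  exact tendsto_atTop_mono (h.mul_le_dist_pow hδ) (tendsto_natCast_atTop_atTop.atTop_mul_const hpos)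

theorem gromovProduct_inv_pow_pow_le (h : HasLongSteps δ g s c) (hδ : IsGromovHyperbolic S δ)
    (m n : ℕ) : gromovProduct s ((g ^ m)⁻¹ • s) (g ^ n • s) ≤ c + 2 * δ := by
  rw [← inv_pow]
  rcases m with _ | m
  · have := gromovProduct_le_dist_left s s (g ^ n • s)
    rw [dist_self] at this
    rw [pow_zero, one_smul]
    linarith [h.nonneg, hδ.nonneg s]
  · have hlong := h.inv.le_gromovProduct_pow_succ hδ m
    rw [dist_inv_smul_self] at hlong
    rcases hδ.le_add_or_le_add s (g⁻¹ • s) (g⁻¹ ^ (m + 1) • s) (g ^ n • s) with hle | hle <;>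
      linarith [h.gromovProduct_inv_pow_le hδ n, h.lt_dist]

theorem le_gromovProduct_pow_pow (h : HasLongSteps δ g s c) (hδ : IsGromovHyperbolic S δ)
    {m n : ℕ} (hmn : m ≤ n) :
    dist s (g ^ m • s) - (c + 2 * δ) ≤ gromovProduct s (g ^ m • s) (g ^ n • s) := by
  obtain ⟨k, rfl⟩ := Nat.exists_eq_add_of_le hmn
  rw [pow_add, mul_smul, gromovProduct_smul_smul]
  linarith [h.gromovProduct_inv_pow_pow_le hδ m k]

theorem exists_convergesToBoundary_pow (h : HasLongSteps δ g s c) (hδ : IsGromovHyperbolic S δ) :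
    ∃ ξ : GromovBoundary S, ConvergesToBoundary (fun n : ℕ => g ^ n • s) ξ := by
  refine ⟨_, (asymptoticSeq_iff s).2 fun R => ?_, rfl⟩
  obtain ⟨N, hN⟩ :=
    eventually_atTop.1 ((h.tendsto_dist_pow hδ).eventually_ge_atTop (R + (c + 2 * δ)))
  refine ⟨N, fun i hi j hj => ?_⟩
  rcases le_total i j with hij | hji
  · linarith [h.le_gromovProduct_pow_pow hδ hij, hN i hi]
  · rw [gromovProduct_comm]
    linarith [h.le_gromovProduct_pow_pow hδ hji, hN j hj]

theorem pow_smul_mem_traceNhd (h : HasLongSteps δ g s c) (hδ : IsGromovHyperbolic S δ) {R : ℝ}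
    (hg : g • s ∈ traceNhd s (R + c + 2 * δ) ξ) {n : ℕ} (hn : 1 ≤ n) :
    g ^ n • s ∈ traceNhd s R ξ := by
  obtain ⟨n, rfl⟩ := Nat.exists_eq_add_of_le' hn
  have := h.nonneg
  have := hδ.nonneg s
  refine mem_traceNhd_of_le_gromovProduct hδ (traceNhd_anti s (by linarith) ξ hg) ?_
  linarith [le_dist_of_mem_traceNhd hg, h.le_gromovProduct_pow_succ hδ n]

end HasLongSteps

/-- If neither `a` nor `b` is loxodromic, where `as` is close to `ξ` and `bs` to `η`, then `a⁻¹s` is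
close to `ξ` and `b⁻¹s` to `η`, and therefore `ab` is loxodromic. -/
theorem exists_hasLongSteps (hδ : IsGromovHyperbolic S δ) (s : S) (hξ : ξ ∈ limitSet G S)
    (hη : η ∈ limitSet G S) (hne : ξ ≠ η) : ∃ (g : G) (c : ℝ), HasLongSteps δ g s c := by
  have h0 := hδ.nonneg s
  obtain ⟨K, hK, hK0⟩ := ((eventually_gromovProduct_le hδ s hne).and (eventually_ge_atTop 0)).exists
  obtain ⟨c, hc⟩ := exists_eventually_hasLongSteps (G := G) hδ s hne
  obtain ⟨R, hlong, hR0⟩ := (hc.and (eventually_ge_atTop 0)).exists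
  set M := R + K + δ
  obtain ⟨a, ha⟩ := (mem_limitSet_iff hδ s ξ).1 hξ (2 * M + 5 * δ)
  obtain ⟨b, hb⟩ := (mem_limitSet_iff hδ s η).1 hη (2 * M + 5 * δ)
  have hM0 : 0 ≤ M := by positivity
  have hKM : K ≤ M := by simp only [M]; linarith
  obtain hloxo | ha_inv := exists_hasLongSteps_or_inv_smul_mem_traceNhd hδ hM0 ha
  · exact ⟨a, hloxo⟩
  obtain hloxo | hb_inv := exists_hasLongSteps_or_inv_smul_mem_traceNhd hδ hM0 hb
  · exact ⟨b, hloxo⟩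
  have hsep : gromovProduct s (a⁻¹ • s) (b • s) ≤ K :=
    hK _ (traceNhd_anti s hKM ξ ha_inv) _ (traceNhd_anti s (by linarith) η hb)
  refine ⟨a * b, c, hlong _ ?_ ?_⟩
  · rw [mul_smul]
    exact smul_mem_traceNhd_of_gromovProduct_le hδ (traceNhd_anti s (by linarith) ξ ha) hsep
  · rw [mul_inv_rev, mul_smul]
    refine smul_mem_traceNhd_of_gromovProduct_le hδ hb_inv ?_
    rwa [inv_inv, gromovProduct_comm]

end Loxodromic

section GeneralType

variable {G : Type*} [Group G] {S : Type*} [MetricSpace S] [MulAction G S] [IsIsometricSMul G S]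
  {δ : ℝ} {s : S} {ξ η : GromovBoundary S}

/-- A point close to one end of a loxodromic element is moved away from itself by an element that
does not fix that end; all other points are moved away from themselves by a high power of the
loxodromic element. -/
theorem HasLongSteps.exists_gromovProduct_smul_self_le (hδ : IsGromovHyperbolic S δ)
    (hfix : ¬ ∃ ξ : GromovBoundary S, ∀ g : G, g • ξ = ξ) {g : G} {c : ℝ}
    (h : HasLongSteps δ g s c) :
    ∃ K : ℝ, ∀ p : S, ∃ a : G, dist s (a • s) ≤ K ∧ gromovProduct s (a • p) p ≤ K := by
  push Not at hfix
  obtain ⟨ξ, hξ⟩ := h.exists_convergesToBoundary_pow hδ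
  obtain ⟨η, hη⟩ := h.inv.exists_convergesToBoundary_pow hδ
  obtain ⟨t, ht⟩ := hfix ξ
  obtain ⟨u, hu⟩ := hfix η
  obtain ⟨T, hT, hU⟩ := ((eventually_gromovProduct_smul_le hδ s ht).and
    (eventually_gromovProduct_smul_le hδ s hu)).exists
  obtain ⟨n, hnξ, hnη, hn⟩ := ((hξ.eventually_mem_traceNhd hδ s (T + δ)).and
    ((hη.eventually_mem_traceNhd hδ s (T + δ)).and
      ((h.tendsto_dist_pow hδ).eventually_gt_atTop (2 * T + 3 * δ)))).exists
  rw [inv_pow] at hnη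
  obtain ⟨K, hKt, hKu, hKn, hK⟩ := ((eventually_ge_atTop (dist s (t • s))).and
    ((eventually_ge_atTop (dist s (u • s))).and ((eventually_ge_atTop (dist s (g ^ n • s))).and
      (eventually_ge_atTop (T + 2 * δ))))).exists
  have hTK : T ≤ K := by linarith [hδ.nonneg s]
  refine ⟨K, fun p => ?_⟩
  rcases le_or_gt (T + δ) (gromovProduct s (g ^ n • s) p) with hpξ | hpξ
  · exact ⟨t, hKt, (hT p (mem_traceNhd_of_le_gromovProduct hδ hnξ hpξ)).trans hTK⟩
  rcases le_or_gt (T + δ) (gromovProduct s ((g ^ n)⁻¹ • s) p) with hpη | hpη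
  · exact ⟨u, hKu, (hU p (mem_traceNhd_of_le_gromovProduct hδ hnη hpη)).trans hTK⟩
  refine ⟨g ^ n, hKn, ?_⟩
  have hlong := gromovProduct_smul_smul (g ^ n) s p
  rcases hδ.le_add_or_le_add s (g ^ n • s) (g ^ n • p) p with hle | hle <;> linarith

namespace IsGeneralType

theorem exists_gromovProduct_smul_le (hG : IsGeneralType G S) (hδ : IsGromovHyperbolic S δ)
    (s : S) :
    ∃ K : ℝ, ∀ p q : S, ∃ a : G, dist s (a • s) ≤ K ∧ gromovProduct s (a • p) q ≤ K := by
  obtain ⟨ξ, hξ, η, hη, hne⟩ := hG.1.nontrivial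
  obtain ⟨g, c, hg⟩ := exists_hasLongSteps hδ s hξ hη hne
  obtain ⟨K, hK⟩ := hg.exists_gromovProduct_smul_self_le hδ hG.2
  refine ⟨K + δ, fun p q => ?_⟩
  obtain ⟨a, ha, hap⟩ := hK p
  have h0 := hδ.nonneg s
  rcases hδ.le_add_or_le_add s (a • p) q p with hle | hle
  · exact ⟨a, by linarith, by linarith⟩
  · refine ⟨1, ?_, ?_⟩
    · rw [one_smul, dist_self]
      linarith [dist_nonneg (x := s) (y := a • s)]
    · rw [one_smul, gromovProduct_comm]
      linarith

/-- If `as` is close to `η` and `bs` is close to `ξ`, then `bka⁻¹` has the required property, where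
`k` is chosen so that `ka⁻¹s` and `b⁻¹s` are separated. -/
theorem exists_pow_smul_mem_traceNhd (hG : IsGeneralType G S) (hδ : IsGromovHyperbolic S δ)
    (s : S) (hξ : ξ ∈ limitSet G S) (hη : η ∈ limitSet G S) (hne : ξ ≠ η) (R : ℝ) :
    ∃ g : G, ∀ n : ℕ, 1 ≤ n → g ^ n • s ∈ traceNhd s R ξ ∧ (g ^ n)⁻¹ • s ∈ traceNhd s R η := by
  obtain ⟨c, hc⟩ := exists_eventually_hasLongSteps (G := G) hδ s hne
  obtain ⟨C, hC⟩ := hG.exists_gromovProduct_smul_le hδ s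
  obtain ⟨M, hlong, hM⟩ := (hc.and (eventually_ge_atTop (R + c + 2 * δ))).exists
  obtain ⟨a, ha⟩ := (mem_limitSet_iff hδ s η).1 hη (M + 2 * C + δ)
  obtain ⟨b, hb⟩ := (mem_limitSet_iff hδ s ξ).1 hξ (M + 2 * C + δ)
  obtain ⟨k, hk, hkab⟩ := hC (a⁻¹ • s) (b⁻¹ • s)
  have hgξ : (b * k * a⁻¹) • s ∈ traceNhd s M ξ := by
    rw [mul_smul, mul_smul]
    refine smul_mem_traceNhd_of_gromovProduct_le hδ hb ?_
    rw [gromovProduct_comm]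
    linarith [dist_nonneg (x := s) (y := k • s)]
  have hgη : (b * k * a⁻¹)⁻¹ • s ∈ traceNhd s M η := by
    rw [mul_inv_rev, inv_inv, mul_inv_rev, mul_smul, mul_smul]
    refine smul_mem_traceNhd_of_gromovProduct_le hδ ha ?_
    rw [← gromovProduct_smul k, smul_inv_smul]
    linarith [gromovProduct_le_add_dist_base (k • s) s (k • a⁻¹ • s) (b⁻¹ • s),
      dist_comm s (k • s)]
  have hg := hlong _ hgξ hgη
  refine ⟨b * k * a⁻¹, fun n hn => ⟨?_, ?_⟩⟩
  · exact hg.pow_smul_mem_traceNhd hδ (traceNhd_anti s hM ξ hgξ) hn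
  · rw [← inv_pow]
    exact hg.inv.pow_smul_mem_traceNhd hδ (traceNhd_anti s hM η hgη) hn

end IsGeneralType

end GeneralType

section Recurrent

variable {G : Type*} [Group G] {H : Subgroup G}

/-- The part of recurrence that the geometric argument needs: every `h ∈ H` has, for every `g`,
a conjugate `g⁻ⁿhgⁿ` with `n ≥ 1` in `H`. -/
def IsElementwiseRecurrent (H : Subgroup G) : Prop :=
  ∀ h ∈ H, ∀ g : G, ∃ n : ℕ, 1 ≤ n ∧ (g ^ n)⁻¹ * h * g ^ n ∈ H

theorem mem_conjSubgroup_iff {g h : G} : h ∈ conjSubgroup g H ↔ g⁻¹ * h * g ∈ H := by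
  rw [conjSubgroup, Subgroup.mem_map_equiv, MulAut.conj_symm_apply]

theorem isOpen_setOf_mem (h : G) : IsOpen[subgroupTopology G] {K : Subgroup G | h ∈ K} := by
  classical
  refine isOpen_induced_iff.2
    ⟨(fun f => f h) ⁻¹' {true}, (isOpen_discrete _).preimage (continuous_apply h), ?_⟩
  ext K
  simp

theorem IsRecurrentSubgroup.isElementwiseRecurrent (hH : IsRecurrentSubgroup H) :
    IsElementwiseRecurrent H := fun h hh g => by
  obtain ⟨n, hn, hn0⟩ := (hH g _ (isOpen_setOf_mem h) hh).exists_gt 0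
  exact ⟨n, hn0, mem_conjSubgroup_iff.1 hn⟩

variable {S : Type*} [MetricSpace S] [MulAction G S] [IsIsometricSMul G S] {δ : ℝ} {h : G}
  {ξ η : GromovBoundary S}

namespace IsElementwiseRecurrent

theorem mem_limitSet (hH : IsElementwiseRecurrent H) (hδ : IsGromovHyperbolic S δ)
    (hG : IsGeneralType G S) (hh : h ∈ H) (hξ : ξ ∈ limitSet G S) (hhξ : h • ξ ≠ ξ)
    (hη : η ∈ limitSet G S) (hne : ξ ≠ η) : η ∈ limitSet H S := by
  obtain ⟨s, -⟩ := id hη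
  refine (mem_limitSet_iff hδ s η).2 fun R => ?_
  obtain ⟨K, hK⟩ := (eventually_gromovProduct_smul_le hδ s hhξ).exists
  obtain ⟨g, hg⟩ := hG.exists_pow_smul_mem_traceNhd hδ s hξ hη hne (max K (R + K + δ))
  obtain ⟨n, hn, hnH⟩ := hH h hh g
  obtain ⟨hgξ, hgη⟩ := hg n hn
  have hsep : gromovProduct s (h • g ^ n • s) (g ^ n • s) ≤ K :=
    hK _ (traceNhd_anti s (le_max_left _ _) ξ hgξ)
  refine ⟨⟨_, hnH⟩, ?_⟩
  rw [Subgroup.mk_smul, mul_assoc, mul_smul, mul_smul]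
  refine smul_mem_traceNhd_of_gromovProduct_le hδ (traceNhd_anti s (le_max_right _ _) η hgη) ?_
  rwa [inv_inv, gromovProduct_comm]

theorem limitSet_eq (hH : IsElementwiseRecurrent H) (hδ : IsGromovHyperbolic S δ)
    (hG : IsGeneralType G S) (hh : h ∈ H) (hξ : ξ ∈ limitSet G S) (hhξ : h • ξ ≠ ξ) :
    limitSet H S = limitSet G S := by
  refine (limitSet_subgroup_subset H).antisymm fun η hη => ?_
  rcases ne_or_eq ξ η with hne | rfl
  · exact hH.mem_limitSet hδ hG hh hξ hhξ hη hne
  · exact hH.mem_limitSet hδ hG hh (smul_mem_limitSet hδ h hξ) ((MulAction.injective h).ne hhξ)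
      hη hhξ

theorem exists_smul_ne (hH : IsElementwiseRecurrent H) (hδ : IsGromovHyperbolic S δ)
    (hG : IsGeneralType G S) (hh : h ∈ H) (hξ : ξ ∈ limitSet G S) (hhξ : h • ξ ≠ ξ)
    (η : GromovBoundary S) : ∃ k ∈ H, k • η ≠ η := by
  obtain ⟨s, -⟩ := id hξ
  obtain ⟨ζ, hζ, hζ_ne⟩ := (hG.1.sdiff (Set.toFinite {ξ, η})).nonempty
  obtain ⟨hζξ, hζη⟩ : ζ ≠ ξ ∧ ζ ≠ η := by simpa using hζ_ne
  obtain ⟨K, hK⟩ := (eventually_gromovProduct_smul_le hδ s hhξ).exists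
  obtain ⟨C, hC⟩ := (eventually_gromovProduct_le hδ s hζη).exists
  obtain ⟨g, hg⟩ := hG.exists_pow_smul_mem_traceNhd hδ s hξ hζ hζξ.symm (max (K + C + δ) C)
  obtain ⟨n, hn, hnH⟩ := hH h hh g
  obtain ⟨hgξ, hgζ⟩ := hg n hn
  obtain ⟨y, hy⟩ := exists_convergesToBoundary η
  have hsep : ∀ᶠ i in atTop, gromovProduct s (h • g ^ n • y i) (g ^ n • y i) ≤ K := by
    filter_upwards [hy.eventually_mem_traceNhd hδ s C] with i hi
    refine hK _ (smul_mem_traceNhd_of_gromovProduct_le hδ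
      (traceNhd_anti s (le_max_left _ _) ξ hgξ) ?_)
    exact hC _ (traceNhd_anti s (le_max_right _ _) ζ hgζ) _ hi
  refine ⟨_, hnH, fun hfix => (hy.smul (g ^ n)).smul_ne hδ hsep.frequently ?_⟩
  rwa [mul_assoc, mul_smul, mul_smul, inv_smul_eq_iff] at hfix

theorem isGeometricallyDense (hH : IsElementwiseRecurrent H) (hδ : IsGromovHyperbolic S δ)
    (hG : IsGeneralType G S) (hHE : ¬ H ≤ ellipticRadical G S) : IsGeometricallyDense S H := by
  obtain ⟨h, hh, hhE⟩ := SetLike.not_le_iff_exists.1 hHE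
  obtain ⟨ξ, hξ, hhξ⟩ : ∃ ξ ∈ limitSet G S, h • ξ ≠ ξ := by
    simpa [ellipticRadical, mem_fixingSubgroup_iff] using hhE
  refine ⟨fun ⟨η, hη⟩ => ?_, hH.limitSet_eq hδ hG hh hξ hhξ⟩
  obtain ⟨k, hk, hkη⟩ := hH.exists_smul_ne hδ hG hh hξ hhξ η
  exact hkη (hη k hk)

end IsElementwiseRecurrent

theorem IsGeometricallyDense.isGeneralType (hH : IsGeometricallyDense S H)
    (hG : IsNonElementary G S) : IsGeneralType H S := by
  refine ⟨by rwa [IsNonElementary, hH.2], fun ⟨ξ, hξ⟩ => hH.1 ⟨ξ, fun h hh => ?_⟩⟩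
  obtain ⟨x, rfl⟩ := Quot.exists_rep ξ
  exact hξ ⟨h, hh⟩

end Recurrent

section Elliptic

variable {G : Type*} [Group G] {S : Type*} [MetricSpace S] [MulAction G S] [IsIsometricSMul G S]
  {δ : ℝ}

theorem exists_dist_smul_le_of_smul_eq (hδ : IsGromovHyperbolic S δ) (s : S)
    {T : Finset (GromovBoundary S)} (hT : 2 < T.card) :
    ∃ C : ℝ, ∀ g : G, (∀ ξ ∈ T, g • ξ = ξ) → dist s (g • s) ≤ C := by
  classical
  have hsep : ∀ᶠ K : ℝ in atTop, ∀ ξ ∈ T, ∀ η ∈ T, ξ ≠ η →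
      ∀ p ∈ traceNhd s K ξ, ∀ q ∈ traceNhd s K η, gromovProduct s p q ≤ K := by
    simp only [Finset.eventually_all, eventually_imp_distrib_left]
    exact fun ξ _ η _ hne => eventually_gromovProduct_le hδ s hne
  obtain ⟨K, hK, hK0⟩ := (hsep.and (eventually_ge_atTop 0)).exists
  refine ⟨2 * (K + δ), fun g hg => ?_⟩
  by_contra! hlt
  have hone_end : ∀ p, dist s p = dist s (g • s) → ∀ ξ ∈ T, p ∈ traceNhd s K ξ →
      ∀ η ∈ T, p ∈ traceNhd s K η → ξ = η := by
    intro p hp ξ hξ hpξ η hη hpη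
    by_contra hne
    have hle := hK ξ hξ η hη hne p hpξ p hpη
    rw [gromovProduct_self] at hle
    linarith [hδ.nonneg s]
  obtain ⟨ξ, hξ, η, hη, hne, hiff⟩ := Finset.exists_ne_map_eq_of_card_lt_of_maps_to
    (t := (Finset.univ : Finset Prop)) (f := fun ξ => g • s ∈ traceNhd s K ξ)
    (by simpa using hT) fun _ _ => Finset.mem_univ _
  have hends := fun ξ hξ => mem_traceNhd_or_inv_smul_mem_traceNhd hδ (hg ξ hξ) hlt.le
  by_cases hgξ : g • s ∈ traceNhd s K ξ
  · exact hne (hone_end _ rfl ξ hξ hgξ η hη (hiff ▸ hgξ))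
  · exact hne (hone_end _ (dist_inv_smul_self g s) ξ hξ ((hends ξ hξ).resolve_left hgξ) η hη
      ((hends η hη).resolve_left fun hgη => hgξ (hiff.symm ▸ hgη)))

theorem IsNonElementary.isElliptic_of_le_ellipticRadical (hG : IsNonElementary G S)
    (hδ : IsGromovHyperbolic S δ) {H : Subgroup G} (hH : H ≤ ellipticRadical G S) :
    IsElliptic H S := fun s => by
  obtain ⟨T, hTΛ, hT⟩ := hG.exists_subset_card_eq 3
  obtain ⟨C, hC⟩ := exists_dist_smul_le_of_smul_eq (G := G) hδ s (T := T) (by omega)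
  refine (Metric.isBounded_closedBall (x := s) (r := C)).subset ?_
  rintro _ ⟨h, rfl⟩
  refine Metric.mem_closedBall'.2 (hC h fun ξ hξ => ?_)
  exact (mem_fixingSubgroup_iff G).1 (hH h.2) ξ (hTΛ hξ)

end Elliptic

end HypAction

theorem mainTheorem2_general {G : Type*} [Group G] {S : Type*} [MetricSpace S] {δ : ℝ}
    (hδ : HypAction.IsGromovHyperbolic S δ)
    [MulAction G S] [IsIsometricSMul G S] (hG : HypAction.IsGeneralType G S)
    (H : Subgroup G) (hH : HypAction.IsElementwiseRecurrent H) :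
    (HypAction.IsGeometricallyDense S H ∨ H ≤ HypAction.ellipticRadical G S) ∧
    (HypAction.IsGeometricallyDense S H → HypAction.IsGeneralType H S) ∧
    (H ≤ HypAction.ellipticRadical G S → HypAction.IsElliptic H S) :=
  ⟨or_iff_not_imp_right.2 (hH.isGeometricallyDense hδ hG), fun hdense => hdense.isGeneralType hG.1,
    hG.1.isElliptic_of_le_ellipticRadical hδ⟩

theorem mainTheorem2 {G : Type*} [Group G] [Countable G]
    {S : Type*} [MetricSpace S] (hS : HypAction.IsHyperbolicSpace S)
    [MulAction G S] [IsIsometricSMul G S] (hG : HypAction.IsGeneralType G S)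
    (H : Subgroup G) (hH : HypAction.IsRecurrentSubgroup H) :
    (HypAction.IsGeometricallyDense S H ∨ H ≤ HypAction.ellipticRadical G S) ∧
    (HypAction.IsGeometricallyDense S H → HypAction.IsGeneralType H S) ∧
    (H ≤ HypAction.ellipticRadical G S → HypAction.IsElliptic H S) := by
  obtain ⟨δ, hδ⟩ := hS.exists_isGromovHyperbolic
  exact mainTheorem2_general hδ hG H hH.isElementwiseRecurrent
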